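/- Let $n\ge 1$ and $N\ge 2$ be integers. For $0<q<\infty$, $\ell^{q,\infty}(\mathbb{Z}^n)$ is the set of sequences $a=\{a_\mu\}_{\mu\in\mathbb{Z}^n}$ with $$\|a\|_{\ell^{q,\infty}}=\sup_{t>0}\, t\;\sharp\{\mu\in\mathbb{Z}^n : |a_\mu|>t\}^{1/q}<\infty .$$ Let $\mathcal{B}_N((\mathbb{Z}^n)^N)$ be the set of all nonnegative functions $V$ on $(\mathbb{Z}^n)^N$ for which there is a constant $c\in(0,\infty)$ such that $$\sum_{\nu_1,\dots,\nu_N\in\mathbb{Z}^n} V(\nu_1,\dots,\nu_N)\,A_0(\nu_1+\dots+\nu_N)\prod_{j=1}^N A_j(\nu_j)\;\le\; c\prod_{j=0}^N\|A_j\|_{\ell^2(\mathbb{Z}^n)}$$ for all nonnegative functions $A_0,A_1,\dots,A_N$ on $\mathbb{Z}^n$ (both sides being understood in $[0,\infty]$, with $0\cdot\infty=0$). (1) Let $2<p_j<\infty$ for $j=1,\dots,N$ with $\sum_{j=1}^N 1/p_j=(N-1)/2$, and let $f_j\in\ell^{p_j,\infty}(\mathbb{Z}^n)$ be nonnegative for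 $j=1,\dots,N$. Then the function $(\nu_1,\dots,\nu_N)\mapsto\prod_{j=1}^N f_j(\nu_j)$ belongs to $\mathcal{B}_N((\mathbb{Z}^n)^N)$. (2) This covers the product weights: if $0<a_j<n/2$ for $j=1,\dots,N$ and $\sum_{j=1}^N a_j=(N-1)n/2$, then, with $|\cdot|$ the Euclidean norm, the function $\mu\mapsto(1+|\mu|)^{-a_j}$ belongs to $\ell^{n/a_j,\infty}(\mathbb{Z}^n)$ for each $j$, and the function $(\nu_1,\dots,\nu_N)\mapsto\prod_{j=1}^N(1+|\nu_j|)^{-a_j}$ belongs to $\mathcal{B}_N((\mathbb{Z}^n)^N)$. -/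

import Mathlib

open scoped ENNReal

noncomputable section

/-- The `ℓ^q` (quasi-)norm `(∑_k |a_k|^q)^{1/q}`, `0 < q < ∞`, of a sequence on an index set `K`,
with value `∞` when the sequence is not in `ℓ^q`. -/
def ellNorm {K E : Type*} [NormedAddCommGroup E] (q : ℝ) (a : K → E) : ℝ≥0∞ :=
  (∑' k, ENNReal.ofReal ‖a k‖ ^ q) ^ (1 / q)

/-- The weak `ℓ^q` (quasi-)norm `sup_{t > 0} t · #{k : |a_k| > t}^{1/q}`, `0 < q < ∞`,
with value `∞` when the supremum is infinite (in particular when one of the sets is infinite). -/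
def weakEllNorm {K E : Type*} [NormedAddCommGroup E] (q : ℝ) (a : K → E) : ℝ≥0∞ :=
  ⨆ t : ℝ, ⨆ _ : 0 < t, ENNReal.ofReal t * ((Set.encard {k | t < ‖a k‖} : ℕ∞) : ℝ≥0∞) ^ (1 / q)

/-- The space `ℓ^{q,∞}(K)`, as a set of sequences. -/
def weakEll (K E : Type*) [NormedAddCommGroup E] (q : ℝ) : Set (K → E) :=
  {a | weakEllNorm q a < ∞}

/-- The class `𝓑_N((ℤ^n)^N)`: the nonnegative functions `V` on `(ℤ^n)^N` for which there is a
constant `0 < c < ∞` with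
`∑_ν V(ν) A₀(ν₁ + ⋯ + ν_N) ∏_{j=1}^N A_j(ν_j) ≤ c ∏_{j=0}^N ‖A_j‖_{ℓ²}`
for all nonnegative functions `A_0, …, A_N` on `ℤ^n`. Both sides are computed in `[0, ∞]`. -/
def classB (N n : ℕ) : Set ((Fin N → (Fin n → ℤ)) → ℝ) :=
  {V | (∀ ν, 0 ≤ V ν) ∧
    ∃ c : ℝ, 0 < c ∧
      ∀ A : Fin (N + 1) → (Fin n → ℤ) → ℝ, (∀ j μ, 0 ≤ A j μ) →
        ∑' ν : Fin N → (Fin n → ℤ),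
            ENNReal.ofReal (V ν * A 0 (∑ j, ν j) * ∏ j : Fin N, A j.succ (ν j)) ≤
          ENNReal.ofReal c * ∏ j : Fin (N + 1), ellNorm 2 (A j)}

/-- The Euclidean length `|μ|` of a lattice point `μ ∈ ℤ^n ⊆ ℝ^n`. -/
def latticeNorm {n : ℕ} (μ : Fin n → ℤ) : ℝ :=
  Real.sqrt (∑ i, (μ i : ℝ) ^ 2)

end

open scoped ENNReal

/-! Split `(ℤ^n)^N` by the index `k` at which `f k (ν k) ^ p k` is smallest. On that region, apply
Cauchy–Schwarz in `ν` to `A₀(∑ ν) ∏_{j≠k} A_j(ν_j)` against `A_k(ν_k) ∏ f_j(ν_j)`. The first square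
sum factors by translation invariance in `ν k` (`tsum_sq_sum_mul_prod_succAbove`). In the second,
fix `ν k = x`: minimality confines each other variable to a level set `f_i ≥ f_k(x)^(p_k/p_i)`,
where weak `ℓ^{p_i}` with `p_i > 2` controls the sum of `f_i²` (`exists_tsum_sq_le_of_mem_weakEll`).
By the condition on `∑ 1/p_j` all powers of `f_k(x)` cancel, leaving `∑ A_k²`
(`tsum_indicator_sq_le`). -/

theorem ENNReal.tsum_pi_prod_eq_prod_tsum {G : Type*} :
    ∀ {M : ℕ} (g : Fin M → G → ℝ≥0∞), ∑' y : Fin M → G, ∏ i, g i (y i) = ∏ i, ∑' x, g i x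
  | 0, g => by simp
  | M + 1, g => by
    rw [← (Fin.consEquiv fun _ => G).tsum_eq, ENNReal.tsum_prod', Fin.prod_univ_succ,
      ← ENNReal.tsum_pi_prod_eq_prod_tsum (fun i => g i.succ), ← ENNReal.tsum_mul_right]
    refine tsum_congr fun x => ?_
    rw [← ENNReal.tsum_mul_left]
    exact tsum_congr fun y => by simp [Fin.consEquiv, Fin.prod_univ_succ]

theorem ENNReal.tsum_mul_le_sqrt_mul_sqrt {K : Type*} (u v : K → ℝ≥0∞) :
    ∑' k, u k * v k ≤ (∑' k, u k ^ 2) ^ (1 / 2 : ℝ) * (∑' k, v k ^ 2) ^ (1 / 2 : ℝ) := by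
  let _ : MeasurableSpace K := ⊤
  have h := ENNReal.lintegral_mul_le_Lp_mul_Lq (MeasureTheory.Measure.count (α := K))
    Real.HolderConjugate.two_two (f := u) (g := v)
    (measurable_from_top.aemeasurable) (measurable_from_top.aemeasurable)
  simpa [MeasureTheory.lintegral_count] using h

/-! ### Level sets of weak `ℓ^p` functions -/

/-- Chebyshev's inequality for the weak `ℓ^p` norm, with a non-strict level set. -/
theorem encard_le_of_weakEllNorm {K : Type*} {p : ℝ} (hp : 0 < p) (f : K → ℝ) {u : ℝ}
    (hu : 0 < u) :
    ((Set.encard {k | u ≤ f k} : ℕ∞) : ℝ≥0∞) ≤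
      weakEllNorm p f ^ p * ENNReal.ofReal ((u / 2) ^ (-p)) := by
  have hu2 : 0 < u / 2 := by positivity
  set E : ℝ≥0∞ := ((Set.encard {k | u / 2 < ‖f k‖} : ℕ∞) : ℝ≥0∞) with hE
  have h1 : ((Set.encard {k | u ≤ f k} : ℕ∞) : ℝ≥0∞) ≤ E := by
    rw [hE]
    refine ENat.toENNReal_le.2 (Set.encard_le_encard fun k (hk : u ≤ f k) => ?_)
    exact lt_of_lt_of_le (by linarith) (hk.trans (le_abs_self _))
  have h2 : ENNReal.ofReal (u / 2) * E ^ (1 / p) ≤ weakEllNorm p f :=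
    le_iSup₂ (f := fun (t : ℝ) (_ : 0 < t) => ENNReal.ofReal t *
      ((Set.encard {k | t < ‖f k‖} : ℕ∞) : ℝ≥0∞) ^ (1 / p)) (u / 2) hu2
  have h3 := ENNReal.rpow_le_rpow h2 hp.le
  rw [ENNReal.mul_rpow_of_nonneg _ _ hp.le, ← ENNReal.rpow_mul, one_div_mul_cancel hp.ne',
    ENNReal.rpow_one, ENNReal.ofReal_rpow_of_pos hu2] at h3
  calc _ ≤ E := h1
    _ = ENNReal.ofReal ((u / 2) ^ p) * E * ENNReal.ofReal ((u / 2) ^ (-p)) := by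
      rw [mul_right_comm, ← ENNReal.ofReal_mul (by positivity), ← Real.rpow_add hu2]
      simp
    _ ≤ _ := by gcongr

/-- For `p > 2`, the square sum over an upper level set of a weak `ℓ^p` function is controlled
by the level. -/
theorem exists_tsum_sq_le_of_mem_weakEll {K : Type*} {p : ℝ} (hp : 2 < p) {f : K → ℝ}
    (hf : f ∈ weakEll K ℝ p) :
    ∃ C : ℝ≥0∞, C ≠ ∞ ∧ ∀ τ : ℝ, 0 < τ →
      ∑' k, {k | τ ≤ f k}.indicator (fun k => ENNReal.ofReal (f k) ^ 2) k ≤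
        C * ENNReal.ofReal (τ ^ (2 - p)) := by
  set W := weakEllNorm p f
  have hW : W ≠ ∞ := (show W < ∞ from hf).ne
  set r : ℝ := 2 ^ (2 - p) with hr
  have hr0 : 0 < r := by positivity
  have hr1 : r < 1 := Real.rpow_lt_one_of_one_lt_of_neg (by norm_num) (by linarith)
  -- The 4 comes from squaring the top `2 ^ (m + 1) * τ` of a dyadic layer, the `2 ^ p` from the
  -- halved level in Chebyshev; the series converges because `p > 2`.
  refine ⟨∑' m : ℕ, W ^ p * ENNReal.ofReal (4 * 2 ^ p) * ENNReal.ofReal r ^ m, ?_, fun τ hτ => ?_⟩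
  · rw [ENNReal.tsum_mul_left, ENNReal.tsum_geometric]
    refine ENNReal.mul_ne_top (ENNReal.mul_ne_top
      (ENNReal.rpow_ne_top_of_nonneg (by linarith) hW) ENNReal.ofReal_ne_top) ?_
    rw [ENNReal.inv_ne_top]
    exact (tsub_pos_of_lt (ENNReal.ofReal_lt_one.2 hr1)).ne'
  calc ∑' k, {k | τ ≤ f k}.indicator (fun k => ENNReal.ofReal (f k) ^ 2) k
      ≤ ∑' k, ∑' m : ℕ, {k | 2 ^ m * τ ≤ f k}.indicator
          (fun _ => ENNReal.ofReal ((2 ^ (m + 1) * τ) ^ 2)) k := by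
        refine ENNReal.tsum_le_tsum fun k => Set.indicator_apply_le' (fun hk => ?_)
          fun _ => zero_le
        replace hk : τ ≤ f k := hk
        obtain ⟨m, hm1, hm2⟩ := exists_nat_pow_near ((one_le_div hτ).2 hk) (one_lt_two (α := ℝ))
        rw [le_div_iff₀ hτ] at hm1
        rw [div_lt_iff₀ hτ] at hm2
        refine le_trans ?_ (ENNReal.le_tsum m)
        rw [Set.indicator_of_mem (show k ∈ {k | 2 ^ m * τ ≤ f k} from hm1),
          ← ENNReal.ofReal_pow (hτ.le.trans hk)]
        have := hτ.le.trans hk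
        gcongr
    _ = ∑' m : ℕ, ((Set.encard {k | 2 ^ m * τ ≤ f k} : ℕ∞) : ℝ≥0∞) *
          ENNReal.ofReal ((2 ^ (m + 1) * τ) ^ 2) := by
        rw [ENNReal.tsum_comm]
        refine tsum_congr fun m => ?_
        rw [← tsum_subtype, ENNReal.tsum_set_const]
    _ ≤ ∑' m : ℕ, W ^ p * ENNReal.ofReal (4 * 2 ^ p) * ENNReal.ofReal r ^ m *
          ENNReal.ofReal (τ ^ (2 - p)) := by
        refine ENNReal.tsum_le_tsum fun m => ?_
        have h2m : (0 : ℝ) < 2 ^ m := by positivity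
        refine (mul_le_mul_left (encard_le_of_weakEllNorm (p := p) (by linarith) f
          (show 0 < 2 ^ m * τ by positivity)) _).trans_eq ?_
        rw [← ENNReal.ofReal_pow hr0.le]
        simp only [mul_assoc]
        congr 1
        repeat rw [← ENNReal.ofReal_mul (by positivity)]
        congr 1
        have e1 : (2 ^ m * τ / 2 : ℝ) ^ (-p) = ((2 : ℝ) ^ m) ^ (-p) * τ ^ (-p) * 2 ^ p := by
          rw [Real.div_rpow (by positivity) (by positivity), Real.mul_rpow h2m.le hτ.le,
            Real.rpow_neg (x := 2) (by norm_num), div_inv_eq_mul]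
        have e2 : r ^ m = ((2 : ℝ) ^ m) ^ (-p) * (2 ^ m) ^ 2 := by
          rw [hr, ← Real.rpow_natCast, ← Real.rpow_mul (by norm_num), mul_comm,
            Real.rpow_mul (by norm_num), Real.rpow_natCast, sub_eq_add_neg, add_comm,
            Real.rpow_add h2m]
          norm_num
        have e3 : τ ^ (2 - p) = τ ^ (-p) * τ ^ 2 := by
          rw [sub_eq_add_neg, add_comm, Real.rpow_add hτ]
          norm_num
        rw [e1, e2, e3]
        ring
    _ = _ := ENNReal.tsum_mul_right

/-! ### Lattice point counts and the power weights -/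

theorem abs_le_latticeNorm {n : ℕ} (μ : Fin n → ℤ) (i : Fin n) : |(μ i : ℝ)| ≤ latticeNorm μ :=
  Real.abs_le_sqrt (Finset.single_le_sum (f := fun i => (μ i : ℝ) ^ 2)
    (fun _ _ => sq_nonneg _) (Finset.mem_univ i))

theorem encard_one_add_latticeNorm_lt_le (n : ℕ) {R : ℝ} (hR : 0 < R) :
    ((Set.encard {μ : Fin n → ℤ | 1 + latticeNorm μ < R} : ℕ∞) : ℝ≥0∞) ≤
      ENNReal.ofReal ((3 * R) ^ n) := by
  -- For `R > 1` a cube side has `2⌊R⌋ + 1 ≤ 3R` points.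
  rcases le_or_gt R 1 with h1 | h1
  · have : {μ : Fin n → ℤ | 1 + latticeNorm μ < R} = ∅ := by
      ext μ
      have : 0 ≤ latticeNorm μ := Real.sqrt_nonneg _
      simp only [Set.mem_ofPred_eq, Set.mem_empty_iff_false, iff_false]
      linarith
    simp [this]
  set S : Finset (Fin n → ℤ) := Fintype.piFinset fun _ => Finset.Icc (-⌊R⌋) ⌊R⌋
  have hsub : {μ : Fin n → ℤ | 1 + latticeNorm μ < R} ⊆ S := by
    intro μ (hμ : 1 + latticeNorm μ < R)
    simp only [S, Finset.mem_coe, Fintype.mem_piFinset, Finset.mem_Icc]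
    intro i
    have := abs_le.1 ((abs_le_latticeNorm μ i).trans (show latticeNorm μ ≤ R by linarith))
    exact ⟨neg_le.1 (Int.le_floor.2 (by push_cast; linarith)), Int.le_floor.2 this.2⟩
  refine (ENat.toENNReal_le.2 (Set.encard_le_encard hsub)).trans ?_
  rw [Set.encard_coe_eq_coe_finsetCard, Fintype.card_piFinset]
  have hfl : (0 : ℤ) ≤ ⌊R⌋ := Int.floor_nonneg.2 hR.le
  have hcard : (((Finset.Icc (-⌊R⌋) ⌊R⌋).card : ℕ) : ℝ) ≤ 3 * R := by
    rw [Int.card_Icc, ← Int.cast_natCast, Int.toNat_of_nonneg (by omega)]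
    push_cast
    linarith [Int.floor_le R]
  rw [ENat.toENNReal_coe, ← ENNReal.ofReal_natCast]
  refine ENNReal.ofReal_le_ofReal ?_
  simp only [Finset.prod_const, Finset.card_univ, Fintype.card_fin]
  push_cast
  gcongr

theorem one_add_latticeNorm_rpow_mem_weakEll {n : ℕ} (hn : 1 ≤ n) {a : ℝ} (ha : 0 < a) :
    (fun μ : Fin n → ℤ => (1 + latticeNorm μ) ^ (-a)) ∈ weakEll (Fin n → ℤ) ℝ ((n : ℝ) / a) := by
  have hn0 : (0 : ℝ) < n := by exact_mod_cast hn
  -- With `R = t ^ (-1/a)`, the count `(3R)^n` gives `t * (3R)^a = 3^a`, free of `t`.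
  refine lt_of_le_of_lt (b := ENNReal.ofReal (3 ^ a)) (iSup₂_le fun t ht => ?_)
    ENNReal.ofReal_lt_top
  set R : ℝ := t ^ (-1 / a) with hRdef
  have hR : 0 < R := by positivity
  have hsub : {μ : Fin n → ℤ | t < ‖(1 + latticeNorm μ) ^ (-a)‖} ⊆
      {μ | 1 + latticeNorm μ < R} := by
    intro μ hμ
    have h0 : 0 < 1 + latticeNorm μ := by
      have : 0 ≤ latticeNorm μ := Real.sqrt_nonneg _
      linarith
    rw [Set.mem_ofPred_eq, Real.norm_of_nonneg (by positivity)] at hμ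
    have := Real.rpow_lt_rpow_of_neg ht hμ (show -1 / a < 0 from div_neg_of_neg_of_pos
      (by norm_num) ha)
    rwa [← Real.rpow_mul h0.le, show -a * (-1 / a) = 1 by field_simp, Real.rpow_one] at this
  calc _ ≤ ENNReal.ofReal t * ENNReal.ofReal ((3 * R) ^ n) ^ (1 / (n / a)) := by
        gcongr
        exact (ENat.toENNReal_le.2 (Set.encard_le_encard hsub)).trans
          (encard_one_add_latticeNorm_lt_le n hR)
    _ = ENNReal.ofReal (3 ^ a) := by
        rw [ENNReal.ofReal_rpow_of_pos (by positivity), ← ENNReal.ofReal_mul ht.le,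
          ← Real.rpow_natCast, ← Real.rpow_mul (by positivity),
          show (n : ℝ) * (1 / (n / a)) = a by field_simp, Real.mul_rpow (by norm_num) hR.le,
          hRdef, ← Real.rpow_mul ht.le, show -1 / a * a = -1 by field_simp, Real.rpow_neg_one]
        congr 1
        field_simp

/-! ### The multilinear estimate -/

theorem ENNReal.tsum_insertNth {G : Type*} {M : ℕ} (k : Fin (M + 1))
    (g : (Fin (M + 1) → G) → ℝ≥0∞) :
    ∑' ν, g ν = ∑' x : G, ∑' y : Fin M → G, g (k.insertNth (α := fun _ => G) x y) := by
  rw [← (Fin.insertNthEquiv (fun _ => G) k).tsum_eq, ENNReal.tsum_prod']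
  rfl

/-- Sum over the variable `ν k` first: the lattice sum of the `k`-free factor. -/
theorem tsum_sq_sum_mul_prod_succAbove {G : Type*} [AddCommGroup G] {M : ℕ} (k : Fin (M + 1))
    (B₀ : G → ℝ≥0∞) (B : Fin (M + 1) → G → ℝ≥0∞) :
    ∑' ν : Fin (M + 1) → G, (B₀ (∑ j, ν j) * ∏ i, B (k.succAbove i) (ν (k.succAbove i))) ^ 2 =
      (∑' x, B₀ x ^ 2) * ∏ i, ∑' x, B (k.succAbove i) x ^ 2 := by
  rw [ENNReal.tsum_insertNth k, ENNReal.tsum_comm, ← ENNReal.tsum_pi_prod_eq_prod_tsum,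
    ← ENNReal.tsum_mul_left]
  refine tsum_congr fun y => ?_
  simp only [Fin.sum_univ_succAbove _ k, Fin.insertNth_apply_same,
    Fin.insertNth_apply_succAbove, mul_pow, ENNReal.tsum_mul_right, Finset.prod_pow]
  rw [← (Equiv.addRight (∑ i, y i)).tsum_eq (fun x => B₀ x ^ 2)]
  rfl

/-- The complementary factor, restricted to the region where `f k (ν k) ^ p k` is minimal. -/
theorem tsum_indicator_sq_le {G : Type*} {M : ℕ} (k : Fin (M + 1)) {p : Fin (M + 1) → ℝ}
    (hp : ∀ j, 2 < p j) (hsum : ∑ j, 1 / p j = (M : ℝ) / 2)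
    {f : Fin (M + 1) → G → ℝ} (hf : ∀ j x, 0 ≤ f j x) {C : Fin (M + 1) → ℝ≥0∞}
    (hC : ∀ j, ∀ τ : ℝ, 0 < τ →
      ∑' x, {x | τ ≤ f j x}.indicator (fun x => ENNReal.ofReal (f j x) ^ 2) x ≤
        C j * ENNReal.ofReal (τ ^ (2 - p j)))
    (b : G → ℝ≥0∞) :
    ∑' ν : Fin (M + 1) → G, ({ν | ∀ i, f k (ν k) ^ p k ≤ f i (ν i) ^ p i}.indicator
        (fun ν => b (ν k) * ∏ j, ENNReal.ofReal (f j (ν j))) ν) ^ 2 ≤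
      (∏ i, C (k.succAbove i)) * ∑' x, b x ^ 2 := by
  have hp0 : ∀ j, 0 < p j := fun j => by linarith [hp j]
  rw [ENNReal.tsum_insertNth k, ← ENNReal.tsum_mul_left]
  refine ENNReal.tsum_le_tsum fun x => ?_
  rcases (hf k x).eq_or_lt with hx | hx
  · refine le_of_eq_of_le (ENNReal.tsum_eq_zero.2 fun y => ?_) zero_le
    rw [sq_eq_zero_iff]
    refine Set.indicator_apply_eq_zero.2 fun _ => ?_
    rw [Fin.prod_univ_succAbove _ k]
    simp [← hx]
  set τ : Fin M → ℝ := fun i => f k x ^ (p k / p (k.succAbove i)) with hτ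
  have hτ0 : ∀ i, 0 < τ i := fun i => by positivity
  -- The exponent of `f k x` is `2 + ∑_{i≠k} (2 p_k/p_i - p_k) = 2 + 2 p_k (M/2 - 1/p_k) - M p_k =
  -- 0`.
  have hprod : ENNReal.ofReal (f k x) ^ 2 *
      ∏ i, ENNReal.ofReal (τ i ^ (2 - p (k.succAbove i))) = 1 := by
    rw [← ENNReal.ofReal_prod_of_nonneg fun i _ => (by positivity),
      ← ENNReal.ofReal_pow hx.le, ← ENNReal.ofReal_mul (by positivity), ← ENNReal.ofReal_one]
    congr 1
    rw [Fin.sum_univ_succAbove _ k] at hsum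
    have hpk := (hp0 k).ne'
    calc f k x ^ 2 * ∏ i, τ i ^ (2 - p (k.succAbove i))
        = f k x ^ (2 : ℝ) * ∏ i, f k x ^ (2 * p k * (1 / p (k.succAbove i)) - p k) := by
          rw [Real.rpow_two]
          congr 1
          refine Finset.prod_congr rfl fun i _ => ?_
          rw [hτ, ← Real.rpow_mul hx.le]
          congr 1
          have := (hp0 (k.succAbove i)).ne'
          field_simp
      _ = 1 := by
          rw [← Real.rpow_sum_of_pos hx, ← Real.rpow_add hx, Finset.sum_sub_distrib,
            ← Finset.mul_sum, eq_sub_of_add_eq' hsum]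
          convert Real.rpow_zero (f k x) using 2
          simp only [Finset.sum_const, Finset.card_univ, Fintype.card_fin, nsmul_eq_mul]
          field_simp
          ring
  calc _ ≤ ∑' y : Fin M → G, b x ^ 2 * ENNReal.ofReal (f k x) ^ 2 *
        ∏ i, {z | τ i ≤ f (k.succAbove i) z}.indicator
          (fun z => ENNReal.ofReal (f (k.succAbove i) z) ^ 2) (y i) := by
        refine ENNReal.tsum_le_tsum fun y => ?_
        by_cases hy : k.insertNth (α := fun _ => G) x y ∈
          {ν : Fin (M + 1) → G | ∀ i, f k (ν k) ^ p k ≤ f i (ν i) ^ p i}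
        · rw [Set.indicator_of_mem hy, Fin.prod_univ_succAbove _ k, ← mul_assoc, mul_pow, mul_pow,
            ← Finset.prod_pow]
          simp only [Fin.insertNth_apply_same, Fin.insertNth_apply_succAbove]
          gcongr with i _
          rw [Set.indicator_of_mem]
          have h := hy (k.succAbove i)
          simp only [Fin.insertNth_apply_same, Fin.insertNth_apply_succAbove] at h
          rw [Set.mem_ofPred_eq, hτ]
          have h' := Real.rpow_le_rpow (by positivity) h (inv_nonneg.2 (hp0 (k.succAbove i)).le)
          rwa [Real.rpow_rpow_inv (hf _ _) (hp0 _).ne', ← Real.rpow_mul hx.le,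
            ← div_eq_mul_inv] at h'
        · rw [Set.indicator_of_notMem hy]
          simp
    _ ≤ b x ^ 2 * ENNReal.ofReal (f k x) ^ 2 *
        ∏ i, (C (k.succAbove i) * ENNReal.ofReal (τ i ^ (2 - p (k.succAbove i)))) := by
        rw [ENNReal.tsum_mul_left, ENNReal.tsum_pi_prod_eq_prod_tsum]
        gcongr with i _
        exact hC _ _ (hτ0 i)
    _ = (∏ i, C (k.succAbove i)) * b x ^ 2 * (ENNReal.ofReal (f k x) ^ 2 *
        ∏ i, ENNReal.ofReal (τ i ^ (2 - p (k.succAbove i)))) := by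
        rw [Finset.prod_mul_distrib]
        ring
    _ = _ := by rw [hprod, mul_one]

theorem ellNorm_two_eq {K : Type*} {A : K → ℝ} (hA : ∀ k, 0 ≤ A k) :
    ellNorm 2 A = (∑' k, ENNReal.ofReal (A k) ^ 2) ^ (1 / 2 : ℝ) := by
  simp only [ellNorm, Real.norm_of_nonneg (hA _), ENNReal.rpow_two]

theorem prod_mem_classB {n N : ℕ} (hN : 2 ≤ N) {p : Fin N → ℝ}
    {f : Fin N → (Fin n → ℤ) → ℝ} (hp : ∀ j, 2 < p j)
    (hsum : ∑ j, 1 / p j = ((N : ℝ) - 1) / 2) (hf : ∀ j μ, 0 ≤ f j μ)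
    (hw : ∀ j, f j ∈ weakEll (Fin n → ℤ) ℝ (p j)) :
    (fun ν : Fin N → (Fin n → ℤ) => ∏ j, f j (ν j)) ∈ classB N n := by
  obtain ⟨M, rfl⟩ : ∃ M, N = M + 1 := ⟨N - 1, by omega⟩
  replace hsum : ∑ j, 1 / p j = (M : ℝ) / 2 := by rw [hsum]; push_cast; ring
  choose C hCtop hC using fun j => exists_tsum_sq_le_of_mem_weakEll (hp j) (hw j)
  set Q : ℝ≥0∞ := ∑ k : Fin (M + 1), (∏ i, C (k.succAbove i)) ^ (1 / 2 : ℝ) with hQ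
  have hQtop : Q ≠ ∞ := ENNReal.sum_ne_top.2 fun k _ =>
    ENNReal.rpow_ne_top_of_nonneg (by norm_num) (ENNReal.prod_ne_top fun i _ => hCtop _)
  -- Adding 1 keeps the constant positive even when `Q = 0`.
  refine ⟨fun ν => Finset.prod_nonneg fun j _ => hf j _, Q.toReal + 1, by positivity,
    fun A hA => ?_⟩
  have hQle : Q ≤ ENNReal.ofReal (Q.toReal + 1) :=
    (ENNReal.le_ofReal_iff_toReal_le hQtop (by positivity)).2 (by linarith)
  refine le_trans ?_ (mul_le_mul_left hQle _)
  set B : Fin (M + 1 + 1) → (Fin n → ℤ) → ℝ≥0∞ := fun j x => ENNReal.ofReal (A j x)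
  have hell : ∀ j, ellNorm 2 (A j) = (∑' x, B j x ^ 2) ^ (1 / 2 : ℝ) :=
    fun j => ellNorm_two_eq (hA j)
  set D : Fin (M + 1) → Set (Fin (M + 1) → (Fin n → ℤ)) :=
    fun k => {ν | ∀ i, f k (ν k) ^ p k ≤ f i (ν i) ^ p i}
  calc _ ≤ ∑' ν : Fin (M + 1) → (Fin n → ℤ), ∑ k,
        (B 0 (∑ j, ν j) * ∏ i, B (k.succAbove i).succ (ν (k.succAbove i))) *
          (D k).indicator (fun ν => B k.succ (ν k) * ∏ j, ENNReal.ofReal (f j (ν j))) ν := by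
        refine ENNReal.tsum_le_tsum fun ν => ?_
        -- The regions `D k` cover everything; overlaps at ties only enlarge the sum.
        obtain ⟨k, -, hk⟩ := Finset.exists_min_image Finset.univ
          (fun i => f i (ν i) ^ p i) Finset.univ_nonempty
        refine le_trans (le_of_eq ?_)
          (Finset.single_le_sum (fun _ _ => zero_le) (Finset.mem_univ k))
        rw [Set.indicator_of_mem (show ν ∈ D k from fun i => hk i (Finset.mem_univ i)),
          ENNReal.ofReal_mul (mul_nonneg (Finset.prod_nonneg fun j _ => hf j _) (hA _ _)),
          ENNReal.ofReal_mul (Finset.prod_nonneg fun j _ => hf j _),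
          ENNReal.ofReal_prod_of_nonneg fun j _ => hf j _,
          ENNReal.ofReal_prod_of_nonneg fun j _ => hA _ _,
          Fin.prod_univ_succAbove (fun j : Fin (M + 1) => ENNReal.ofReal (A j.succ (ν j))) k]
        ring
    _ = ∑ k, ∑' ν : Fin (M + 1) → (Fin n → ℤ),
        (B 0 (∑ j, ν j) * ∏ i, B (k.succAbove i).succ (ν (k.succAbove i))) *
          (D k).indicator (fun ν => B k.succ (ν k) * ∏ j, ENNReal.ofReal (f j (ν j))) ν :=
        Summable.tsum_finsetSum fun _ _ => ENNReal.summable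
    _ ≤ ∑ k : Fin (M + 1), (∏ i, C (k.succAbove i)) ^ (1 / 2 : ℝ) *
          ∏ j, ellNorm 2 (A j) := by
        refine Finset.sum_le_sum fun k _ => (ENNReal.tsum_mul_le_sqrt_mul_sqrt _ _).trans ?_
        rw [tsum_sq_sum_mul_prod_succAbove k (B 0) fun j => B j.succ]
        refine (mul_le_mul_right (ENNReal.rpow_le_rpow (tsum_indicator_sq_le k hp hsum hf hC
          (B k.succ)) (by norm_num)) _).trans_eq ?_
        simp only [hell, ENNReal.prod_rpow_of_nonneg (show (0 : ℝ) ≤ 1 / 2 by norm_num)]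
        rw [← ENNReal.mul_rpow_of_nonneg _ _ (by norm_num),
          ← ENNReal.mul_rpow_of_nonneg _ _ (by norm_num), Fin.prod_univ_succ,
          Fin.prod_univ_succAbove (fun j : Fin (M + 1) => ∑' x, B j.succ x ^ 2) k]
        congr 1
        ring
    _ = _ := by rw [hQ, Finset.sum_mul]

theorem proposition3p4 (n N : ℕ) (hn : 1 ≤ n) (hN : 2 ≤ N) :
    (∀ (p : Fin N → ℝ) (f : Fin N → (Fin n → ℤ) → ℝ),
      (∀ j, 2 < p j) →
      ∑ j, 1 / p j = ((N : ℝ) - 1) / 2 →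
      (∀ j μ, 0 ≤ f j μ) →
      (∀ j, f j ∈ weakEll (Fin n → ℤ) ℝ (p j)) →
      (fun ν : Fin N → (Fin n → ℤ) => ∏ j, f j (ν j)) ∈ classB N n) ∧
    (∀ a : Fin N → ℝ,
      (∀ j, 0 < a j ∧ a j < (n : ℝ) / 2) →
      ∑ j, a j = ((N : ℝ) - 1) * (n : ℝ) / 2 →
      (∀ j, (fun μ : Fin n → ℤ => (1 + latticeNorm μ) ^ (-(a j))) ∈
        weakEll (Fin n → ℤ) ℝ ((n : ℝ) / a j)) ∧
      (fun ν : Fin N → (Fin n → ℤ) => ∏ j, (1 + latticeNorm (ν j)) ^ (-(a j))) ∈ classB N n) := by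
  refine ⟨fun p f hp hsum hf hw => prod_mem_classB hN hp hsum hf hw, fun a ha hsum => ?_⟩
  have hw := fun j => one_add_latticeNorm_rpow_mem_weakEll hn (ha j).1
  have hn0 : (0 : ℝ) < n := by exact_mod_cast hn
  refine ⟨hw, prod_mem_classB hN (p := fun j => (n : ℝ) / a j)
    (f := fun j μ => (1 + latticeNorm μ) ^ (-(a j))) (fun j => ?_) ?_ (fun j μ => ?_) hw⟩
  · rw [lt_div_iff₀ (ha j).1]
    linarith [(ha j).2]
  · simp only [one_div_div]
    rw [← Finset.sum_div, hsum]
    field_simp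
  · have : 0 ≤ latticeNorm μ := Real.sqrt_nonneg _
    positivity
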